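/- All graphs are finite and simple, and $\log$ is the natural logarithm. For a graph $H$ let $\mathcal{P}_n(H)$ be the set of all labelled graphs on the vertex set $\{1,\dots,n\}$ that do not contain $H$ as a (not necessarily induced) subgraph. For an integer $t\ge 0$ let $K_{r+1}(t,\dots,t)$ be the complete $(r+1)$-partite graph with all $r+1$ parts of size $t$. Then for every integer $r\ge 2$ and every real $\varepsilon>0$ there is $\delta=\delta(r,\varepsilon)>0$ such that, for all sufficiently large $n$, $$\log_2\left|\mathcal{P}_n\left(K_{r+1}\left(\left\lfloor \delta(\log n)^{1/r}\right\rfloor,\dots,\left\lfloor \delta(\log n)^{1/r}\right\rfloor\right)\right)\right|\le\left(1-\frac1r+\varepsilon\right)\binom n2 .$$ -/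

import Mathlib

/-- The set of all labelled graphs of order `n` (simple graphs on the vertex set `Fin n`) that do
not contain `H` as a (not necessarily induced) subgraph. -/
def labelledFreeGraphs (n : ℕ) {W : Type*} (H : SimpleGraph W) : Set (SimpleGraph (Fin n)) :=
  {G | H.Free G}

/-- The complete `k`-partite graph with all `k` parts of size `t`: its vertices are the pairs
`(i, a)` with `i : Fin k` (the part) and `a : Fin t`, and two vertices are adjacent exactly when
they lie in different parts. -/
abbrev completePartiteEqualParts (k t : ℕ) : SimpleGraph (Fin k × Fin t) :=
  SimpleGraph.completeEquipartiteGraph k t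

open Finset

/-! Szemerédi's regularity lemma gives a dichotomy (`many_cliques_or_almost_le_blowup`). If the
reduced graph contains `K_{r+1}`, the counting lemma yields at least `c n^(r+1)` cliques. Otherwise
`G` lies, up to `η n²` edges, in a blow-up of a `K_{r+1}`-free graph on `M` vertices, with `M`
independent of `n`.

In the first case the cliques form a dense set of `(r+1)`-tuples, and Erdős' box theorem turns them
into a `K_{r+1}(t,…,t)`. Its condition has the shape `4t ≤ c^((4t)^r) n`, which is where `t ≈ δ (log
n)^(1/r)` comes from. So only graphs of the second kind count: there are `2^O(n)` blow-ups, each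
with at most `(1 - 1/r) n²/2` edges by Turán, and the exceptional edges add a factor `2^(2κn²)`. -/

/-! ### Erdős' box theorem for dense sets of tuples -/

/-- A set of tuples is counted by fibering over the tail. -/
lemma card_eq_sum_card_cons_tail {α : Type*} [Fintype α] [DecidableEq α] {k : ℕ}
    (S : Finset (Fin (k + 1) → α)) :
    #S = ∑ y : Fin k → α, #{x : α | (Fin.cons x y : Fin (k + 1) → α) ∈ S} := by
  rw [card_eq_sum_card_fiberwise (f := Fin.tail) (t := univ) (by simp)]
  refine sum_congr rfl fun y _ ↦ ?_
  refine card_nbij' (fun z ↦ z 0) (fun x ↦ Fin.cons x y) ?_ ?_ ?_ ?_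
  · intro z hz
    simp only [coe_filter, Set.mem_ofPred_eq, mem_univ, true_and] at hz ⊢
    rw [← hz.2, Fin.cons_self_tail]
    exact hz.1
  · intro x hx
    simpa using hx
  · intro z hz
    simp only [coe_filter, Set.mem_ofPred_eq] at hz
    rw [← hz.2]
    exact Fin.cons_self_tail z
  · intro x _
    simp

/-- A set of tuples is counted by fibering over the first entry. -/
lemma card_eq_sum_card_cons_head {α : Type*} [Fintype α] [DecidableEq α] {k : ℕ}
    (S : Finset (Fin (k + 1) → α)) :
    #S = ∑ x : α, #{y : Fin k → α | (Fin.cons x y : Fin (k + 1) → α) ∈ S} := by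
  rw [card_eq_sum_card_cons_tail]
  simp_rw [card_filter]
  exact sum_comm

/-- The number of injections from `Fin t` into a set `D` is at least `(|D| - t) ^ t`. -/
lemma pow_sub_le_card_embedding_into {α : Type*} [Fintype α] [DecidableEq α] (D : Finset α)
    (t : ℕ) : (#D + 1 - t) ^ t ≤ #{e : Fin t ↪ α | ∀ i, e i ∈ D} := by
  refine (Nat.pow_sub_le_descFactorial #D t).trans ?_
  have h : Fintype.card (Fin t ↪ D) = (#D).descFactorial t := by
    rw [Fintype.card_embedding_eq, Fintype.card_coe, Fintype.card_fin]
  rw [← h, ← card_univ]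
  refine card_le_card_of_injOn (fun e ↦ e.trans (Function.Embedding.subtype _)) ?_ ?_
  · intro e _
    simp
  · intro e _ e' _ h
    ext i
    simpa using DFunLike.congr_fun h i

/-- In a dense set of `(k + 1)`-tuples there are `t` first entries having many common tails. -/
lemma exists_embedding_many_tails {α : Type*} [Fintype α] [DecidableEq α] {k t : ℕ} (ht : 1 ≤ t)
    {c : ℝ} (hc : 0 < c) (hc4 : c ≤ 1 / 4) (S : Finset (Fin (k + 1) → α))
    (hS : c * (Fintype.card α : ℝ) ^ (k + 1) ≤ #S) (htn : 4 * t ≤ c * Fintype.card α) :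
    ∃ e : Fin t ↪ α, c ^ (4 * t) * (Fintype.card α : ℝ) ^ k ≤
      #{y : Fin k → α | ∀ i, (Fin.cons (e i) y : Fin (k + 1) → α) ∈ S} := by
  set n : ℝ := (Fintype.card α : ℝ) with hn
  have ht1 : (1 : ℝ) ≤ t := by exact_mod_cast ht
  have hn0 : 0 < n := by
    by_contra! h
    nlinarith
  let d : (Fin k → α) → Finset α := fun y ↦ {x : α | (Fin.cons x y : Fin (k + 1) → α) ∈ S}
  -- Tails outside `Y` account for at most half of the guaranteed size of `S`, so `Y` is large.
  let Y : Finset (Fin k → α) := {y | c / 2 * n ≤ #(d y)}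
  have hY : c / 2 * n ^ k ≤ #Y := by
    have h1 : (#S : ℝ) = ∑ y, (#(d y) : ℝ) := by
      rw [card_eq_sum_card_cons_tail S]
      push_cast
      rfl
    have h2 : ∑ y, (#(d y) : ℝ) ≤ ∑ y, ((if y ∈ Y then n else 0) + c / 2 * n) := by
      refine sum_le_sum fun y _ ↦ ?_
      split_ifs with hy
      · have : (#(d y) : ℝ) ≤ n := Nat.cast_le.2 (card_le_univ _)
        have : 0 ≤ c / 2 * n := by positivity
        linarith
      · have : ¬ (c / 2 * n ≤ #(d y)) := by simpa [Y] using hy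
        linarith
    have h3 : ∑ y : Fin k → α, ((if y ∈ Y then n else 0) + c / 2 * n)
        = #Y * n + n ^ k * (c / 2 * n) := by
      rw [sum_add_distrib, ← sum_filter]
      simp [hn]
    have h4 : c / 2 * n ^ k * n ≤ #Y * n := by
      rw [← h1, h3] at h2
      have := hS.trans h2
      rw [pow_succ] at this
      linarith
    exact le_of_mul_le_mul_right h4 hn0
  have hcount : ∀ y ∈ Y, (c / 4 * n) ^ t ≤
      (#{e : Fin t ↪ α | ∀ i, (Fin.cons (e i) y : Fin (k + 1) → α) ∈ S} : ℝ) := by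
    intro y hy
    have hy' : c / 2 * n ≤ #(d y) := by simpa [Y] using hy
    have h1 : c / 4 * n ≤ ((#(d y) + 1 - t : ℕ) : ℝ) := by
      have hle : t ≤ #(d y) + 1 := by
        have : (t : ℝ) ≤ #(d y) + 1 := by linarith
        exact_mod_cast this
      rw [Nat.cast_sub hle]
      push_cast
      linarith
    have h2 := pow_sub_le_card_embedding_into (d y) t
    simp only [d, mem_filter, mem_univ, true_and] at h1 h2
    exact (pow_le_pow_left₀ (by positivity) h1 t).trans (by exact_mod_cast h2)
  -- Double counting of pairs (injection, common tail); averaging over injections then gives `e`.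
  have hswap : ∑ y ∈ Y, #{e : Fin t ↪ α | ∀ i, (Fin.cons (e i) y : Fin (k + 1) → α) ∈ S} ≤
      ∑ e : Fin t ↪ α, #{y : Fin k → α | ∀ i, (Fin.cons (e i) y : Fin (k + 1) → α) ∈ S} := by
    simp_rw [card_filter]
    rw [sum_comm]
    exact sum_le_sum fun e _ ↦ sum_le_sum_of_subset (subset_univ _)
  have htn' : t ≤ Fintype.card α := by
    have : (t : ℝ) ≤ Fintype.card α := by nlinarith
    exact_mod_cast this
  have hne : (univ : Finset (Fin t ↪ α)).Nonempty := by
    rw [univ_nonempty_iff, Function.Embedding.nonempty_iff_card_le, Fintype.card_fin]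
    exact htn'
  have hcardE : (#(univ : Finset (Fin t ↪ α)) : ℝ) ≤ n ^ t := by
    rw [card_univ, Fintype.card_embedding_eq, Fintype.card_fin, hn]
    exact_mod_cast Nat.descFactorial_le_pow _ _
  obtain ⟨e, -, he⟩ := exists_le_of_sum_le (s := univ)
    (f := fun _ : Fin t ↪ α ↦ c ^ (4 * t) * n ^ k)
    (g := fun e ↦ (#{y : Fin k → α | ∀ i, (Fin.cons (e i) y : Fin (k + 1) → α) ∈ S} : ℝ)) hne (by
      -- A crude bound whose single power iterates cleanly: after `j` rounds the density is `c ^ ((4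
      -- * t) ^ j)`.
      have hcc : c ^ (4 * t) ≤ c / 2 * (c / 4) ^ t := by
        have h1 : c ^ 2 ≤ c / 2 := by nlinarith
        have h2 : c ^ 2 ≤ c / 4 := by nlinarith
        calc c ^ (4 * t) ≤ c ^ (2 + 2 * t) :=
              pow_le_pow_of_le_one hc.le (by linarith) (by omega)
          _ = c ^ 2 * (c ^ 2) ^ t := by rw [pow_add, pow_mul]
          _ ≤ _ := by gcongr
      calc ∑ _e : Fin t ↪ α, c ^ (4 * t) * n ^ k
          = #(univ : Finset (Fin t ↪ α)) * (c ^ (4 * t) * n ^ k) := by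
            rw [sum_const, nsmul_eq_mul]
        _ ≤ n ^ t * (c / 2 * (c / 4) ^ t * n ^ k) := by gcongr
        _ = c / 2 * n ^ k * (c / 4 * n) ^ t := by rw [mul_pow]; ring
        _ ≤ #Y * (c / 4 * n) ^ t := by gcongr
        _ = ∑ y ∈ Y, (c / 4 * n) ^ t := by rw [sum_const, nsmul_eq_mul]
        _ ≤ ∑ y ∈ Y,
            (#{e : Fin t ↪ α | ∀ i, (Fin.cons (e i) y : Fin (k + 1) → α) ∈ S} : ℝ) :=
            sum_le_sum hcount
        _ ≤ _ := by exact_mod_cast hswap)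
  exact ⟨e, he⟩

/-- **Erdős' theorem**: a dense set of `k`-tuples contains a large box. -/
theorem exists_box_subset_of_dense {α : Type*} [Fintype α] [DecidableEq α] {t : ℕ} (ht : 1 ≤ t)
    (k : ℕ) {c : ℝ} (hc : 0 < c) (hc4 : c ≤ 1 / 4) (S : Finset (Fin k → α))
    (hS : c * (Fintype.card α : ℝ) ^ k ≤ #S)
    (htn : ∀ j < k, 4 * t ≤ c ^ ((4 * t) ^ j) * Fintype.card α) :
    ∃ A : Fin k → Fin t ↪ α, ∀ g : Fin k → Fin t, (fun i ↦ A i (g i)) ∈ S := by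
  induction k generalizing c with
  | zero =>
    have hpos : 0 < #S := by
      have : (0 : ℝ) < #S := hc.trans_le (by simpa only [pow_zero, mul_one] using hS)
      exact_mod_cast this
    obtain ⟨x, hx⟩ := card_pos.1 hpos
    refine ⟨fun i ↦ i.elim0, fun g ↦ ?_⟩
    convert hx using 1
  | succ k ih =>
    obtain ⟨e, he⟩ := exists_embedding_many_tails ht hc hc4 S hS (by simpa using htn 0 (by omega))
    have hc' : c ^ (4 * t) ≤ 1 / 4 := by
      refine le_trans ?_ hc4
      exact pow_le_of_le_one hc.le (by linarith) (by omega)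
    obtain ⟨A, hA⟩ := ih (pow_pos hc (4 * t)) hc' _ he (by
      intro j hj
      have := htn (j + 1) (by omega)
      rwa [pow_succ', pow_mul] at this)
    refine ⟨Fin.cons e A, fun g ↦ ?_⟩
    have h := hA (fun i ↦ g i.succ)
    simp only [mem_filter, mem_univ, true_and] at h
    convert h (g 0) using 1
    funext i
    refine Fin.cases ?_ (fun i ↦ ?_) i <;> simp

/-! ### Lower regularity and clique counting -/

namespace SimpleGraph

/-- A pair of vertex sets is lower regular if all its large subpairs have density at least `d`. -/
def LowerRegular {α : Type*} (G : SimpleGraph α) [DecidableRel G.Adj] (ε d : ℝ)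
    (s t : Finset α) : Prop :=
  ∀ s' ⊆ s, ∀ t' ⊆ t, ε * #s ≤ #s' → ε * #t ≤ #t' → d * (#s' * #t') ≤ #(G.interedges s' t')

/-- The tuples of pairwise adjacent vertices with the `i`-th entry in `V i`. -/
def cliqueTuples {α : Type*} [Fintype α] [DecidableEq α] (G : SimpleGraph α) [DecidableRel G.Adj]
    {k : ℕ} (V : Fin k → Finset α) : Finset (Fin k → α) :=
  {x | (∀ i, x i ∈ V i) ∧ ∀ i j, i < j → G.Adj (x i) (x j)}

lemma cons_mem_cliqueTuples {α : Type*} [Fintype α] [DecidableEq α] {G : SimpleGraph α}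
    [DecidableRel G.Adj] {k : ℕ} {V : Fin (k + 1) → Finset α} {x : α} {y : Fin k → α} :
    (Fin.cons x y : Fin (k + 1) → α) ∈ G.cliqueTuples V ↔
      x ∈ V 0 ∧ y ∈ G.cliqueTuples fun i ↦ {z ∈ V i.succ | G.Adj x z} := by
  simp only [cliqueTuples, mem_filter, mem_univ, true_and, Fin.forall_fin_succ, Fin.cons_zero,
    Fin.cons_succ, Fin.succ_pos, Fin.succ_lt_succ_iff, forall_true_left, Fin.not_lt_zero, false_imp_iff, true_and]
  constructor
  · rintro ⟨⟨h1, h2⟩, h3, h4⟩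
    exact ⟨h1, fun i ↦ ⟨h2 i, h3 i⟩, h4⟩
  · rintro ⟨h1, h2, h4⟩
    exact ⟨⟨h1, fun i ↦ (h2 i).1⟩, fun i ↦ (h2 i).2, h4⟩

/-- Otherwise the low-degree vertices, paired with all of `t`, would form a large subpair of density
below `d`. -/
lemma LowerRegular.card_lowDegree_le {α : Type*} [DecidableEq α] {G : SimpleGraph α}
    [DecidableRel G.Adj] {ε d : ℝ} {s t : Finset α} (h : G.LowerRegular ε d s t) (hε0 : 0 ≤ ε) (hε : ε ≤ 1) :
    (#{x ∈ s | (#{y ∈ t | G.Adj x y} : ℝ) < d * #t} : ℝ) ≤ ε * #s := by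
  by_contra! hlt
  set B : Finset α := {x ∈ s | (#{y ∈ t | G.Adj x y} : ℝ) < d * #t} with hB
  have h1 := h B (filter_subset _ _) t subset_rfl hlt.le
    (mul_le_of_le_one_left (Nat.cast_nonneg _) hε)
  have h2 : (#(G.interedges B t) : ℝ) ≤ ∑ x ∈ B, (#{y ∈ t | G.Adj x y} : ℝ) := by
    have h3 := card_biUnion_le (s := B)
      (t := fun x ↦ ({y ∈ t | G.Adj x y}).map ⟨(x, ·), Prod.mk_right_injective x⟩)
    rw [← Rel.interedges_eq_biUnion] at h3
    simp only [card_map] at h3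
    exact_mod_cast h3
  rcases B.eq_empty_or_nonempty with hb | hb
  · rw [hb] at hlt
    simp only [card_empty, Nat.cast_zero] at hlt
    have : 0 ≤ ε * #s := by positivity
    linarith
  · have h3 : ∑ x ∈ B, (#{y ∈ t | G.Adj x y} : ℝ) < ∑ x ∈ B, d * #t :=
      sum_lt_sum_of_nonempty hb fun x hx ↦ (mem_filter.1 hx).2
    rw [sum_const, nsmul_eq_mul] at h3
    linarith

/-- **Counting lemma** for cliques. -/
theorem exists_le_card_cliqueTuples {d : ℝ} (hd : 0 < d) (hd1 : d ≤ 1) (k : ℕ) :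
    ∃ ε : ℝ, 0 < ε ∧ ε ≤ 1 ∧ ∃ c : ℝ, 0 < c ∧
      ∀ {α : Type} [Fintype α] [DecidableEq α] (G : SimpleGraph α) [DecidableRel G.Adj]
        (V : Fin k → Finset α), (∀ i j, i < j → G.LowerRegular ε d (V i) (V j)) →
        c * ∏ i, (#(V i) : ℝ) ≤ #(G.cliqueTuples V) := by
  induction k with
  | zero =>
    refine ⟨1, one_pos, le_rfl, 1, one_pos, fun G V _ ↦ ?_⟩
    simp [cliqueTuples]
  | succ k ih =>
    obtain ⟨ε, hε, hε1, c, hc, H⟩ := ih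
    -- The factor `d` keeps neighbourhoods lower regular after they shrink to a proportion `d`; `1 /
    -- (2 * (k + 1))` makes the `k` sets of atypical vertices cover at most half of `V 0`.
    refine ⟨min (ε * d) (1 / (2 * (k + 1))), by positivity,
      (min_le_left _ _).trans (mul_le_one₀ hε1 hd.le hd1), c * d ^ k / 2, by positivity, ?_⟩
    intro α _ _ G _ V hV
    set ε' := min (ε * d) (1 / (2 * (k + 1) : ℝ)) with hε'
    have hε'1 : ε' ≤ 1 := (min_le_left _ _).trans (mul_le_one₀ hε1 hd.le hd1)
    have hε'0 : 0 ≤ ε' := by positivity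
    let B : Fin k → Finset α := fun j ↦
      {x ∈ V 0 | (#{y ∈ V j.succ | G.Adj x y} : ℝ) < d * #(V j.succ)}
    let X : Finset α := V 0 \ univ.biUnion B
    have hX : (#(V 0) : ℝ) / 2 ≤ #X := by
      have h1 : (#(univ.biUnion B) : ℝ) ≤ k * (ε' * #(V 0)) := by
        calc (#(univ.biUnion B) : ℝ) ≤ ∑ j, (#(B j) : ℝ) := by exact_mod_cast card_biUnion_le
          _ ≤ ∑ j : Fin k, ε' * #(V 0) :=
            sum_le_sum fun j _ ↦ (hV 0 j.succ j.succ_pos).card_lowDegree_le hε'0 hε'1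
          _ = _ := by simp
      have h2 : (k : ℝ) * ε' ≤ 1 / 2 := by
        calc (k : ℝ) * ε' ≤ k * (1 / (2 * (k + 1))) := by gcongr; exact min_le_right _ _
          _ ≤ 1 / 2 := by
            rw [mul_one_div, div_le_div_iff₀ (by positivity) (by positivity)]
            linarith
      have h3 : (#(V 0) : ℝ) ≤ #X + #(univ.biUnion B) := by
        exact_mod_cast card_le_card_sdiff_add_card
      have h4 : (0 : ℝ) ≤ #(V 0) := by positivity
      nlinarith
    have hfib : ∀ x ∈ X, c * d ^ k * ∏ i : Fin k, (#(V i.succ) : ℝ) ≤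
        #{y : Fin k → α | (Fin.cons x y : Fin (k + 1) → α) ∈ G.cliqueTuples V} := by
      intro x hx
      have hx0 : x ∈ V 0 := (mem_sdiff.1 hx).1
      have hdeg : ∀ j : Fin k, d * #(V j.succ) ≤ (#{y ∈ V j.succ | G.Adj x y} : ℝ) := by
        intro j
        by_contra! hlt
        exact (mem_sdiff.1 hx).2 (mem_biUnion.2 ⟨j, mem_univ _, mem_filter.2 ⟨hx0, hlt⟩⟩)
      have h1 := H G (fun i ↦ {z ∈ V i.succ | G.Adj x z}) (by
        intro i j hij s' hs' t' ht' hs ht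
        refine hV i.succ j.succ (Fin.succ_lt_succ_iff.2 hij) s' (hs'.trans (filter_subset _ _)) t'
          (ht'.trans (filter_subset _ _)) (le_trans ?_ hs) (le_trans ?_ ht)
        · calc ε' * #(V i.succ) ≤ ε * d * #(V i.succ) := by gcongr; exact min_le_left _ _
            _ = ε * (d * #(V i.succ)) := by ring
            _ ≤ _ := by gcongr; exact hdeg i
        · calc ε' * #(V j.succ) ≤ ε * d * #(V j.succ) := by gcongr; exact min_le_left _ _
            _ = ε * (d * #(V j.succ)) := by ring
            _ ≤ _ := by gcongr; exact hdeg j)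
      calc c * d ^ k * ∏ i : Fin k, (#(V i.succ) : ℝ)
          = c * ∏ i : Fin k, d * (#(V i.succ) : ℝ) := by
            rw [prod_mul_distrib]
            simp [mul_assoc]
        _ ≤ c * ∏ i : Fin k, (#{y ∈ V i.succ | G.Adj x y} : ℝ) := by
            gcongr with i
            exact hdeg i
        _ ≤ _ := h1
        _ ≤ _ := Nat.cast_le.2 <| card_le_card fun y hy ↦
            mem_filter.2 ⟨mem_univ _, cons_mem_cliqueTuples.2 ⟨hx0, hy⟩⟩
    rw [card_eq_sum_card_cons_head, Fin.prod_univ_succ]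
    push_cast
    calc c * d ^ k / 2 * ((#(V 0) : ℝ) * ∏ i : Fin k, (#(V i.succ) : ℝ))
        = (#(V 0) : ℝ) / 2 * (c * d ^ k * ∏ i : Fin k, (#(V i.succ) : ℝ)) := by ring
      _ ≤ #X * (c * d ^ k * ∏ i : Fin k, (#(V i.succ) : ℝ)) :=
          mul_le_mul_of_nonneg_right hX <| mul_nonneg (mul_nonneg hc.le (pow_nonneg hd.le k)) <|
            prod_nonneg fun _ _ ↦ Nat.cast_nonneg _
      _ = ∑ x ∈ X, (c * d ^ k * ∏ i : Fin k, (#(V i.succ) : ℝ)) := by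
          rw [sum_const, nsmul_eq_mul]
      _ ≤ ∑ x ∈ X,
          (#{y : Fin k → α | (Fin.cons x y : Fin (k + 1) → α) ∈ G.cliqueTuples V} : ℝ) :=
          sum_le_sum hfib
      _ ≤ _ := sum_le_univ_sum_of_nonneg fun _ ↦ Nat.cast_nonneg _

end SimpleGraph

/-! ### Regularity: many cliques or a bounded blow-up -/

namespace SimpleGraph

/-- Uniformity lets the density of a large subpair drop by at most `ε ≤ d` from `2 * d`. -/
lemma IsUniform.lowerRegular {α : Type*} {G : SimpleGraph α} [DecidableRel G.Adj] {ε ε' d : ℝ}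
    {s t : Finset α} (h : G.IsUniform ε s t) (hε : ε ≤ ε') (hεd : ε ≤ d)
    (hd : 2 * d ≤ (G.edgeDensity s t : ℝ)) : G.LowerRegular ε' d s t := by
  intro s' hs' t' ht' hs ht
  have h1 := h hs' ht'
    (le_trans (by rw [mul_comm]; gcongr) hs) (le_trans (by rw [mul_comm]; gcongr) ht)
  have h2 : d ≤ (G.edgeDensity s' t' : ℝ) := by
    rw [abs_sub_lt_iff] at h1
    linarith
  rw [edgeDensity_def] at h2
  push_cast at h2
  -- An empty side makes the density a junk `0 / 0`, but then the claim is trivial.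
  rcases (#s' * #t').eq_zero_or_pos with h0 | h0
  · have h0' : (#s' * #t' : ℝ) = 0 := by exact_mod_cast h0
    rw [h0', mul_zero]
    positivity
  · exact (le_div_iff₀ (by exact_mod_cast h0)).1 h2

/-- The reduced graph on the parts of a partition: the dense uniform pairs. -/
def partsGraph {α : Type*} [DecidableEq α] {A : Finset α} (P : Finpartition A) (G : SimpleGraph α)
    [DecidableRel G.Adj] (ε d : ℝ) : SimpleGraph P.parts where
  Adj U V := U ≠ V ∧ G.IsUniform ε U.1 V.1 ∧ d ≤ (G.edgeDensity U.1 V.1 : ℝ)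
  symm.symm U V h := ⟨h.1.symm, h.2.1.symm, by rw [edgeDensity_comm]; exact h.2.2⟩
  loopless := ⟨fun _ h ↦ h.1 rfl⟩

/-- The part of a partition of the whole space that contains a given point. -/
def toPart {α : Type*} [DecidableEq α] [Fintype α] (P : Finpartition (univ : Finset α)) (a : α) :
    P.parts :=
  ⟨P.part a, P.part_mem.2 (mem_univ a)⟩

/-- A lost edge lies in a non-uniform pair, inside one part, or in a sparse pair. The three sets of
ordered pairs have size at most `4ε`, `η/2` and `4d` times `n²`; each edge is counted twice. -/
lemma card_edgeFinset_sdiff_partsGraph_le {α : Type*} [DecidableEq α] [Fintype α] [Nonempty α]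
    {G : SimpleGraph α} [DecidableRel G.Adj] {P : Finpartition (univ : Finset α)} {ε d η : ℝ}
    {H : SimpleGraph α} [Fintype H.edgeSet] (hH : H = (partsGraph P G ε d).comap (toPart P))
    (hε : 0 < ε) (hd : 0 ≤ d) (hη : 0 < η) (hP : P.IsEquipartition) (hPε : P.IsUniform G ε)
    (hP' : 4 / η ≤ #P.parts) :
    (#(G.edgeFinset \ H.edgeFinset) : ℝ) ≤ (2 * ε + η / 4 + 2 * d) * (Fintype.card α : ℝ) ^ 2 := by
  classical
  let A := (P.nonUniforms G ε).biUnion fun (U, V) ↦ U ×ˢ V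
  let B := P.parts.biUnion offDiag
  let C := (P.sparsePairs G d).biUnion fun (U, V) ↦ G.interedges U V
  have hsub : ((univ : Finset (α × α)).filter fun (x, y) ↦ (G \ H).Adj x y) ⊆ A ∪ B ∪ C := by
    rintro ⟨x, y⟩ hxy
    simp only [mem_filter, mem_univ, true_and, sdiff_adj] at hxy
    obtain ⟨hG, hnH⟩ := hxy
    have hx := P.mem_part (mem_univ x)
    have hy := P.mem_part (mem_univ y)
    have hU := P.part_mem.2 (mem_univ x)
    have hV := P.part_mem.2 (mem_univ y)
    simp only [A, B, C, mem_union, mem_biUnion, Prod.exists, mem_product, mem_offDiag,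
      P.mk_mem_nonUniforms, Finpartition.mk_mem_sparsePairs, mem_interedges_iff]
    by_cases hUV : P.part x = P.part y
    · exact Or.inl <| Or.inr ⟨_, hU, hx, hUV ▸ hy, hG.ne⟩
    by_cases hu : G.IsUniform ε (P.part x) (P.part y)
    · refine Or.inr ⟨_, _, ⟨hU, hV, hUV, ?_⟩, hx, hy, hG⟩
      by_contra! hden
      refine hnH ?_
      rw [hH, comap_adj]
      exact ⟨fun h ↦ hUV (congrArg Subtype.val h), hu, hden⟩
    · exact Or.inl <| Or.inl ⟨_, _, ⟨hU, hV, hUV, hu⟩, hx, hy⟩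
  have h1 : (2 * #(G.edgeFinset \ H.edgeFinset) : ℝ) ≤ #A + #B + #C := by
    have h := (card_le_card hsub).trans
      ((card_union_le _ _).trans (Nat.add_le_add_right (card_union_le _ _) _))
    have hsd (_ : Fintype (G \ H).edgeSet) :
        (G \ H).edgeFinset = G.edgeFinset \ H.edgeFinset := by
      ext e
      simp only [mem_edgeFinset, mem_sdiff, edgeSet_sdiff, Set.mem_sdiff]
    rw [← two_mul_card_edgeFinset, hsd] at h
    exact_mod_cast h
  have hA : (#A : ℝ) < 4 * ε * #(univ : Finset α) ^ 2 :=
    hP.sum_nonUniforms_lt univ_nonempty hε hPε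
  have hB : (#B : ℝ) ≤ η / 2 * #(univ : Finset α) ^ 2 := hP.card_biUnion_offDiag_le hη hP'
  have hC : (#C : ℝ) ≤ 4 * d * #(univ : Finset α) ^ 2 := hP.card_interedges_sparsePairs_le hd
  rw [card_univ] at hA hB hC
  nlinarith

lemma card_div_le_card_part {α : Type*} [DecidableEq α] [Fintype α]
    {P : Finpartition (univ : Finset α)} (hP : P.IsEquipartition) {M : ℕ} (hM : #P.parts ≤ M)
    {s : Finset α} (hs : s ∈ P.parts) : (Fintype.card α : ℝ) / (2 * M) ≤ #s := by
  have hk : 0 < #P.parts := card_pos.2 ⟨s, hs⟩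
  have h1 : Fintype.card α / #P.parts ≤ #s := hP.average_le_card_part hs
  have h2 : Fintype.card α < 2 * #P.parts * (Fintype.card α / #P.parts) := by
    have hle : #P.parts ≤ Fintype.card α := P.card_parts_le_card
    have h3 := Nat.div_add_mod (Fintype.card α) #P.parts
    have h4 := Nat.mod_lt (Fintype.card α) hk
    have h5 : #P.parts * 1 ≤ #P.parts * (Fintype.card α / #P.parts) :=
      Nat.mul_le_mul_left _ ((Nat.one_le_div_iff hk).2 hle)
    rw [mul_assoc]
    omega
  have hM0 : 0 < M := hk.trans_le hM
  rw [div_le_iff₀ (by positivity)]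
  have h3 : Fintype.card α ≤ #s * (2 * M) := by
    calc Fintype.card α ≤ 2 * #P.parts * (Fintype.card α / #P.parts) := h2.le
      _ ≤ 2 * M * #s := by gcongr
      _ = _ := by ring
  exact_mod_cast h3

open scoped Classical in
/-- A graph either has many `k`-cliques, or is nearly contained in a blow-up of a `K_k`-free graph
of bounded order. -/
theorem many_cliques_or_almost_le_blowup (k : ℕ) {η : ℝ} (hη : 0 < η) (hη1 : η ≤ 1) :
    ∃ M : ℕ, ∃ c : ℝ, 0 < c ∧ ∃ N : ℕ, ∀ n : ℕ, N ≤ n → ∀ G : SimpleGraph (Fin n),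
      c * (n : ℝ) ^ k ≤ #(G.cliqueTuples fun _ : Fin k ↦ univ) ∨
      ∃ f : Fin n → Fin M, ∃ R : SimpleGraph (Fin M), R.CliqueFree k ∧
        (#(G.edgeFinset \ (R.comap f).edgeFinset) : ℝ) ≤ η * (n : ℝ) ^ 2 := by
  -- The reduced graph uses threshold `2 * d`, so with `ε ≤ d` the loss is at most `6 * d + η / 4 ≤
  -- η`.
  set d : ℝ := η / 16 with hd
  obtain ⟨ε₀, hε₀, -, c, hc, H⟩ := exists_le_card_cliqueTuples (d := d) (by positivity)
    (by linarith) k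
  set ε := min ε₀ d with hε
  have hεpos : 0 < ε := by positivity
  set l : ℕ := ⌈4 / η⌉₊ with hl
  set M := SzemerediRegularity.bound ε l with hM
  have hM0 : 0 < M := SzemerediRegularity.bound_pos ..
  refine ⟨M, c * (1 / (2 * M)) ^ k, by positivity, max l 1, fun n hn G ↦ ?_⟩
  have : NeZero n := ⟨by have := le_max_right l 1; omega⟩
  obtain ⟨P, hP, hPl, hPM, hPu⟩ := szemeredi_regularity G hεpos
    (l := l) (by rw [Fintype.card_fin]; exact (le_max_left _ _).trans hn)
  by_cases hfree : (partsGraph P G ε (2 * d)).CliqueFree k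
  · right
    -- Relabelling the parts inside `Fin M` makes the range of reduced graphs independent of `G` and
    -- `n`.
    let e : P.parts ↪ Fin M :=
      (P.parts.equivFin.toEmbedding.trans (Fin.castLEEmb hPM))
    refine ⟨e ∘ toPart P, (partsGraph P G ε (2 * d)).map e, ?_, ?_⟩
    · have : Nonempty P.parts := ⟨toPart P 0⟩
      exact (cliqueFree_map_iff (f := e)).2 hfree
    · have hcomap : ((partsGraph P G ε (2 * d)).map e).comap (e ∘ toPart P) =
          (partsGraph P G ε (2 * d)).comap (toPart P) := by
        rw [← comap_comap, comap_map_eq]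
      have hle := card_edgeFinset_sdiff_partsGraph_le hcomap hεpos (by positivity) hη hP hPu
        ((Nat.le_ceil _).trans (by exact_mod_cast hPl))
      refine (le_of_eq (by congr!)).trans (hle.trans ?_)
      rw [Fintype.card_fin]
      have : ε ≤ d := min_le_right _ _
      gcongr
      linarith
  · left
    obtain ⟨φ⟩ := not_cliqueFree_iff_top_isContained k |>.1 hfree
    have hadj : ∀ i j, i < j → G.LowerRegular ε₀ d (φ i).1 (φ j).1 := by
      intro i j hij
      have h : (partsGraph P G ε (2 * d)).Adj (φ i) (φ j) := φ.toHom.map_adj hij.ne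
      exact h.2.1.lowerRegular (min_le_left _ _) (min_le_right _ _) h.2.2
    calc c * (1 / (2 * M : ℝ)) ^ k * (n : ℝ) ^ k = c * ∏ _i : Fin k, (n : ℝ) / (2 * M) := by
          rw [prod_const, card_univ, Fintype.card_fin, mul_assoc, ← mul_pow]
          ring
      _ ≤ c * ∏ i : Fin k, (#(φ i).1 : ℝ) := by
          gcongr with i
          have := card_div_le_card_part hP hPM (φ i).2
          rwa [Fintype.card_fin] at this
      _ ≤ _ := H G (fun i ↦ (φ i).1) hadj
      _ ≤ _ := Nat.cast_le.2 <| card_le_card fun x hx ↦ by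
          simp only [cliqueTuples, mem_filter, mem_univ, true_and, implies_true] at hx ⊢
          exact hx.2

/-- A graph with many `k`-cliques contains a large complete equipartite graph. -/
theorem completeEquipartiteGraph_isContained_of_card_cliqueTuples {α : Type*} [Fintype α]
    [DecidableEq α] (G : SimpleGraph α) [DecidableRel G.Adj] {k t : ℕ} (ht : 1 ≤ t) {c : ℝ}
    (hc : 0 < c) (hc4 : c ≤ 1 / 4)
    (hG : c * (Fintype.card α : ℝ) ^ k ≤ #(G.cliqueTuples fun _ : Fin k ↦ univ))
    (htn : ∀ j < k, 4 * t ≤ c ^ ((4 * t) ^ j) * Fintype.card α) :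
    completeEquipartiteGraph k t ⊑ G := by
  obtain ⟨A, hA⟩ := exists_box_subset_of_dense ht k hc hc4 _ hG htn
  have hlt : ∀ i j a b, i < j → G.Adj (A i a) (A j b) := by
    intro i j a b hij
    -- The box corner using `a` in coordinate `i` and `b` elsewhere is a clique containing both
    -- vertices.
    have h := hA fun m ↦ if m = i then a else b
    simp only [cliqueTuples, mem_filter, mem_univ, true_and, implies_true] at h
    simpa [hij.ne'] using h i j hij
  have hne : ∀ i j a b, i ≠ j → G.Adj (A i a) (A j b) := by
    intro i j a b hij
    rcases lt_or_gt_of_ne hij with h | h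
    · exact hlt i j a b h
    · exact (hlt j i b a h).symm
  refine ⟨⟨fun p ↦ A p.1 p.2, fun {p q} hpq ↦ hne _ _ _ _ ?_⟩, ?_⟩
  · simpa [completeEquipartiteGraph_adj] using hpq
  · rintro ⟨i, a⟩ ⟨j, b⟩ h
    rcases eq_or_ne i j with rfl | hij
    · simpa using h
    · exact absurd h (hne i j a b hij).ne

end SimpleGraph

/-! ### Counting graphs close to a blow-up -/

/-- The number of small subsets of a set is bounded by a Chernoff type estimate. -/
lemma card_filter_card_le_le {β : Type*} [DecidableEq β] (E : Finset β) {s x : ℝ} (hx : 0 < x)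
    (hx1 : x ≤ 1) : (#{D ∈ E.powerset | (#D : ℝ) ≤ s} : ℝ) ≤ x ^ (-s) * (1 + x) ^ #E := by
  have h1 : ∑ D ∈ E.powerset, x ^ #D = (1 + x) ^ #E := by
    have := Finset.sum_pow_mul_eq_add_pow x 1 E
    simpa [add_comm] using this
  rw [← h1, mul_sum, card_eq_sum_ones, Nat.cast_sum]
  calc ∑ D ∈ E.powerset with (#D : ℝ) ≤ s, ((1 : ℕ) : ℝ)
      ≤ ∑ D ∈ E.powerset with (#D : ℝ) ≤ s, x ^ (-s) * x ^ #D := by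
        refine sum_le_sum fun D hD ↦ ?_
        rw [← Real.rpow_natCast, ← Real.rpow_add hx, Nat.cast_one]
        refine Real.one_le_rpow_of_pos_of_le_one_of_nonpos hx hx1 ?_
        linarith [(mem_filter.1 hD).2]
    _ ≤ _ := sum_le_sum_of_subset_of_nonneg (filter_subset _ _) fun _ _ _ ↦ by positivity

/-- For every `κ > 0`, an `N`-set with `N ≤ n ^ 2` has at most `2 ^ (2 κ n ^ 2)` subsets of size at
most `η n ^ 2`, provided that `η` is small. -/
lemma exists_card_filter_card_le_le_two_rpow {κ : ℝ} (hκ : 0 < κ) (hκ1 : κ ≤ 1) :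
    ∃ η : ℝ, 0 < η ∧ η ≤ 1 ∧ ∀ (n : ℕ) {β : Type} [DecidableEq β] (E : Finset β), #E ≤ n ^ 2 →
      (#{D ∈ E.powerset | (#D : ℝ) ≤ η * (n : ℝ) ^ 2} : ℝ) ≤ 2 ^ (2 * κ * (n : ℝ) ^ 2) := by
  -- Then `(1 + x) ^ #E ≤ 2 ^ (κ n²)`, while `η = κ / (L + 1)` bounds `x ^ (-η n²)` by the same
  -- quantity.
  set x : ℝ := 2 ^ κ - 1 with hx
  have hx0 : 0 < x := by
    have := Real.one_lt_rpow (x := 2) (by norm_num) hκ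
    linarith
  have hx1 : x ≤ 1 := by
    have := Real.rpow_le_rpow_of_exponent_le (x := 2) (by norm_num) hκ1
    rw [Real.rpow_one] at this
    linarith
  have hL : 0 ≤ Real.logb 2 x⁻¹ :=
    Real.logb_nonneg (by norm_num) ((one_le_inv₀ hx0).2 hx1)
  set L := Real.logb 2 x⁻¹ with hLdef
  refine ⟨κ / (L + 1), by positivity, ?_, fun n β _ E hE ↦ ?_⟩
  · rw [div_le_one (by positivity)]
    linarith
  refine (card_filter_card_le_le E hx0 hx1).trans ?_
  have hxL : x = 2 ^ (-L) := by
    rw [hLdef, Real.logb_inv, neg_neg, Real.rpow_logb (by norm_num) (by norm_num) hx0]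
  have h1x : 1 + x = 2 ^ κ := by rw [hx]; ring
  rw [h1x]
  nth_rewrite 1 [hxL]
  rw [← Real.rpow_mul (by norm_num), ← Real.rpow_mul_natCast (by norm_num),
    ← Real.rpow_add (by norm_num)]
  refine Real.rpow_le_rpow_of_exponent_le (by norm_num) ?_
  have h1 : (#E : ℝ) ≤ (n : ℝ) ^ 2 := by exact_mod_cast hE
  have h2 : L * (κ / (L + 1)) ≤ κ := by
    rw [mul_div_assoc', div_le_iff₀ (by positivity)]
    nlinarith
  have h3 : (0 : ℝ) ≤ (n : ℝ) ^ 2 := by positivity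
  nlinarith [mul_le_mul_of_nonneg_left h1 hκ.le, mul_le_mul_of_nonneg_right h2 h3]

namespace SimpleGraph

open scoped Classical in
/-- The graphs that are nearly contained in a fixed graph `C` are few. -/
lemma card_filter_card_edgeFinset_sdiff_le {α : Type*} [Fintype α] [DecidableEq α]
    (C : SimpleGraph α) (s : ℝ) :
    #{G : SimpleGraph α | (#(G.edgeFinset \ C.edgeFinset) : ℝ) ≤ s} ≤
      2 ^ #C.edgeFinset *
        #{D ∈ (⊤ : SimpleGraph α).edgeFinset.powerset | (#D : ℝ) ≤ s} := by
  rw [← card_powerset, ← card_product]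
  refine card_le_card_of_injOn
    (fun G ↦ (G.edgeFinset ∩ C.edgeFinset, G.edgeFinset \ C.edgeFinset)) ?_ ?_
  · intro G hG
    simp only [coe_filter, mem_univ, true_and, Set.mem_ofPred_eq] at hG
    simp only [coe_product, Set.mem_prod, mem_coe, mem_powerset, mem_filter]
    exact ⟨inter_subset_right, sdiff_subset.trans (edgeFinset_mono le_top), hG⟩
  -- `G` is recovered as the union of its edges inside and outside `C`.
  · intro G _ G' _ h
    simp only [Prod.mk.injEq] at h
    rw [← edgeFinset_inj, ← sdiff_union_inter G.edgeFinset C.edgeFinset, h.1, h.2,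
      sdiff_union_inter]

/-- A blow-up of a `K_k`-free graph is `K_k`-free. -/
lemma CliqueFree.comap_of_cliqueFree {α β : Type*} {R : SimpleGraph β} {k : ℕ}
    (hR : R.CliqueFree k) (f : α → β) : (R.comap f).CliqueFree k := by
  by_contra h
  obtain ⟨φ⟩ := (not_cliqueFree_iff_top_isContained k).1 h
  have hadj : ∀ i j, i ≠ j → R.Adj (f (φ i)) (f (φ j)) := fun i j hij ↦ φ.toHom.map_adj hij
  refine (not_cliqueFree_iff_top_isContained k).2 ⟨⟨⟨fun i ↦ f (φ i), hadj _ _⟩, ?_⟩⟩ hR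
  intro i j hij
  by_contra hne
  exact (hadj i j hne).ne hij

open scoped Classical in
/-- **Turán's bound** in real form. -/
lemma CliqueFree.card_edgeFinset_le_real {α : Type*} [Fintype α] {G : SimpleGraph α} {r : ℕ}
    (hr : 0 < r) (h : G.CliqueFree (r + 1)) :
    (#G.edgeFinset : ℝ) ≤ (1 - 1 / (r : ℝ)) * ((Fintype.card α : ℝ) ^ 2 / 2) := by
  have h1 : 2 * r * #G.edgeFinset ≤ (r - 1) * Fintype.card α ^ 2 := by
    refine le_trans (Nat.mul_le_mul_left _ ?_)
      (mul_card_edgeFinset_turanGraph_le (n := Fintype.card α) (r := r))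
    rw [card_edgeFinset_turanGraph]
    exact h.card_edgeFinset_le
  have h2 : (2 * r * #G.edgeFinset : ℝ) ≤ (r - 1) * (Fintype.card α : ℝ) ^ 2 := by
    have : (((r - 1 : ℕ) : ℝ)) = r - 1 := by rw [Nat.cast_sub hr, Nat.cast_one]
    rw [← this]
    exact_mod_cast h1
  have hr' : (0 : ℝ) < r := by exact_mod_cast hr
  have h3 : (1 - 1 / (r : ℝ)) * ((Fintype.card α : ℝ) ^ 2 / 2) =
      (r - 1) * (Fintype.card α : ℝ) ^ 2 / (2 * r) := by
    field_simp
  rw [h3, le_div_iff₀ (by positivity)]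
  linarith

open scoped Classical in
/-- The graphs that are nearly contained in a blow-up of a `K_{r+1}`-free graph of bounded order
are few. -/
lemma card_filter_almost_le_blowup_le {n M r : ℕ} (hr : 0 < r) (s : ℝ) :
    (#{G : SimpleGraph (Fin n) | ∃ f : Fin n → Fin M, ∃ R : SimpleGraph (Fin M),
        R.CliqueFree (r + 1) ∧ (#(G.edgeFinset \ (R.comap f).edgeFinset) : ℝ) ≤ s} : ℝ) ≤
      (M : ℝ) ^ n * (2 : ℝ) ^ M ^ 2 * (2 : ℝ) ^ ((1 - 1 / (r : ℝ)) * ((n : ℝ) ^ 2 / 2)) *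
        #{D ∈ (⊤ : SimpleGraph (Fin n)).edgeFinset.powerset | (#D : ℝ) ≤ s} := by
  set b : ℝ := (#{D ∈ (⊤ : SimpleGraph (Fin n)).edgeFinset.powerset | (#D : ℝ) ≤ s} : ℝ) with hb
  let I : Finset ((Fin n → Fin M) × SimpleGraph (Fin M)) := {p | p.2.CliqueFree (r + 1)}
  have hsub : ({G : SimpleGraph (Fin n) | ∃ f : Fin n → Fin M, ∃ R : SimpleGraph (Fin M),
      R.CliqueFree (r + 1) ∧ (#(G.edgeFinset \ (R.comap f).edgeFinset) : ℝ) ≤ s} : Finset _) ⊆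
      I.biUnion fun p ↦ {G | (#(G.edgeFinset \ (p.2.comap p.1).edgeFinset) : ℝ) ≤ s} := by
    intro G hG
    obtain ⟨f, R, hR, h⟩ := (mem_filter.1 hG).2
    exact mem_biUnion.2 ⟨(f, R), by simpa [I] using hR, by simpa using h⟩
  have hI : (#I : ℝ) ≤ (M : ℝ) ^ n * (2 : ℝ) ^ M ^ 2 := by
    have h1 : #I ≤ M ^ n * Fintype.card (SimpleGraph (Fin M)) := by
      refine (card_le_univ _).trans (le_of_eq ?_)
      rw [Fintype.card_prod, Fintype.card_fun, Fintype.card_fin, Fintype.card_fin]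
    have h2 : Fintype.card (SimpleGraph (Fin M)) ≤ 2 ^ M ^ 2 := by
      have hinj : Function.Injective fun R : SimpleGraph (Fin M) ↦
          ({p | R.Adj p.1 p.2} : Finset (Fin M × Fin M)) := by
        intro R R' hRR
        ext a b
        simpa using Finset.ext_iff.1 hRR (a, b)
      refine (Fintype.card_le_of_injective _ hinj).trans (le_of_eq ?_)
      rw [Fintype.card_finset, Fintype.card_prod, Fintype.card_fin, sq]
    exact_mod_cast h1.trans (Nat.mul_le_mul_left _ h2)
  have hp : ∀ p ∈ I, (#{G : SimpleGraph (Fin n) |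
      (#(G.edgeFinset \ (p.2.comap p.1).edgeFinset) : ℝ) ≤ s} : ℝ) ≤
      (2 : ℝ) ^ ((1 - 1 / (r : ℝ)) * ((n : ℝ) ^ 2 / 2)) * b := by
    intro p hp
    have hfree : (p.2.comap p.1).CliqueFree (r + 1) :=
      (mem_filter.1 hp).2.comap_of_cliqueFree p.1
    have hT := hfree.card_edgeFinset_le_real hr
    rw [Fintype.card_fin] at hT
    have hC := Nat.cast_le (α := ℝ).2 (card_filter_card_edgeFinset_sdiff_le (p.2.comap p.1) s)
    rw [Nat.cast_mul, Nat.cast_pow, Nat.cast_ofNat] at hC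
    refine (le_of_eq (by congr!)).trans (hC.trans ?_)
    refine mul_le_mul_of_nonneg_right ?_ (Nat.cast_nonneg _)
    rw [← Real.rpow_natCast]
    exact Real.rpow_le_rpow_of_exponent_le (by norm_num) hT
  calc _ ≤ ∑ p ∈ I, (#{G : SimpleGraph (Fin n) |
      (#(G.edgeFinset \ (p.2.comap p.1).edgeFinset) : ℝ) ≤ s} : ℝ) := by
        exact_mod_cast (card_le_card hsub).trans card_biUnion_le
    _ ≤ #I * ((2 : ℝ) ^ ((1 - 1 / (r : ℝ)) * ((n : ℝ) ^ 2 / 2)) * b) := by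
        rw [← nsmul_eq_mul]
        exact sum_le_card_nsmul _ _ _ hp
    _ ≤ (M : ℝ) ^ n * (2 : ℝ) ^ M ^ 2 *
        ((2 : ℝ) ^ ((1 - 1 / (r : ℝ)) * ((n : ℝ) ^ 2 / 2)) * b) :=
        mul_le_mul_of_nonneg_right hI (by positivity)
    _ = _ := by ring

end SimpleGraph

/-! ### Choice of `δ` and the final estimate -/

/-- For `t = ⌊δ (log n) ^ (1 / r)⌋` with small `δ`, boxes of side `t` exist in dense sets of
`(r + 1)`-tuples. -/
lemma exists_four_mul_floor_le {r : ℕ} (hr : 1 ≤ r) {c : ℝ} (hc : 0 < c) (hc1 : c < 1) :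
    ∃ δ : ℝ, 0 < δ ∧ ∃ N : ℕ, ∀ n : ℕ, N ≤ n → ∀ t : ℕ, 1 ≤ t →
      (t : ℝ) ≤ δ * Real.log n ^ (1 / (r : ℝ)) →
      ∀ j < r + 1, (4 * t : ℝ) ≤ c ^ ((4 * t) ^ j) * n := by
  set L : ℝ := -Real.log c with hL
  have hL0 : 0 < L := by
    have := Real.log_neg hc hc1
    linarith
  -- Since `(4t)^r ≤ 4δ log n`, the bound `4δ ≤ 1` gives `4t ≤ log n ≤ √n`, and `4δL ≤ 1/2` gives
  -- `c^((4t)^r) ≥ 1/√n`.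
  set δ : ℝ := 1 / 4 * min 1 (1 / (2 * L)) with hδ
  have hδ0 : 0 < δ := by positivity
  have h4δ1 : 4 * δ ≤ 1 := by
    have := min_le_left 1 (1 / (2 * L))
    linarith
  have h4δ2 : 4 * δ * L ≤ 1 / 2 := by
    have := min_le_right 1 (1 / (2 * L))
    calc 4 * δ * L ≤ 1 / (2 * L) * L := by gcongr; linarith
      _ = 1 / 2 := by field_simp
  have hev : ∀ᶠ x : ℝ in Filter.atTop, Real.log x ≤ x ^ (1 / 2 : ℝ) := by
    have h := (isLittleO_log_rpow_atTop (r := 1 / 2) (by norm_num)).bound (c := 1) one_pos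
    filter_upwards [h, Filter.eventually_ge_atTop 1] with x hx hx1
    rw [one_mul, Real.norm_of_nonneg (Real.log_nonneg hx1),
      Real.norm_of_nonneg (by positivity)] at hx
    exact hx
  obtain ⟨N, hN⟩ := Filter.eventually_atTop.1 (tendsto_natCast_atTop_atTop.eventually hev)
  refine ⟨δ, hδ0, max N 1, fun n hn t ht htδ j hj ↦ ?_⟩
  have hn1 : (1 : ℝ) ≤ n := by exact_mod_cast (le_max_right N 1).trans hn
  have hn0 : (0 : ℝ) < n := by linarith
  have hlog : 0 ≤ Real.log n := Real.log_nonneg hn1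
  have hlog2 : Real.log n ≤ (n : ℝ) ^ (1 / 2 : ℝ) := hN n ((le_max_left _ _).trans hn)
  have h4t1 : (1 : ℝ) ≤ 4 * t := by
    have : (1 : ℝ) ≤ t := by exact_mod_cast ht
    linarith
  have hpow : (4 * t : ℝ) ^ r ≤ 4 * δ * Real.log n := by
    calc (4 * t : ℝ) ^ r ≤ (4 * δ * Real.log n ^ (1 / (r : ℝ))) ^ r :=
          pow_le_pow_left₀ (by linarith) (by linarith) r
      _ = (4 * δ) ^ r * Real.log n := by
          rw [mul_pow, one_div, Real.rpow_inv_natCast_pow hlog (by omega)]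
      _ ≤ 4 * δ * Real.log n := by
          gcongr
          exact pow_le_of_le_one (by positivity) h4δ1 (by omega)
  have h1 : (4 * t : ℝ) ≤ (n : ℝ) ^ (1 / 2 : ℝ) := by
    calc (4 * t : ℝ) ≤ (4 * t : ℝ) ^ r := le_self_pow₀ h4t1 (by omega)
      _ ≤ 4 * δ * Real.log n := hpow
      _ ≤ 1 * Real.log n := by gcongr
      _ ≤ _ := by linarith
  have h2 : (n : ℝ) ^ (1 / 2 : ℝ) ≤ c ^ ((4 * t) ^ r) * n := by
    have hc' : c ^ ((4 * t) ^ r) = Real.exp (-L * (4 * t : ℝ) ^ r) := by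
      rw [hL, neg_neg, Real.exp_mul, Real.exp_log hc, ← Real.rpow_natCast]
      push_cast
      rfl
    have hn' : (n : ℝ) = Real.exp (Real.log n) := (Real.exp_log hn0).symm
    rw [hc', Real.rpow_def_of_pos hn0]
    conv_rhs => rw [hn']
    rw [← Real.exp_add, Real.exp_le_exp]
    have := mul_le_mul_of_nonneg_left hpow hL0.le
    have := mul_le_mul_of_nonneg_right h4δ2 hlog
    linarith
  refine h1.trans (h2.trans ?_)
  refine mul_le_mul_of_nonneg_right ?_ hn0.le
  -- As `c < 1`, the largest exponent `j = r` is the worst case.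
  exact pow_le_pow_of_le_one hc.le hc1.le (Nat.pow_le_pow_right (by omega) (by omega))

open scoped Classical in
lemma labelledFreeGraphs_ncard_le {n r t : ℕ} {c η : ℝ} {M : ℕ} (hc : 0 < c) (hc4 : c ≤ 1 / 4)
    (hM : ∀ G : SimpleGraph (Fin n),
      c * (n : ℝ) ^ (r + 1) ≤ #(G.cliqueTuples fun _ : Fin (r + 1) ↦ univ) ∨
      ∃ f : Fin n → Fin M, ∃ R : SimpleGraph (Fin M), R.CliqueFree (r + 1) ∧
        (#(G.edgeFinset \ (R.comap f).edgeFinset) : ℝ) ≤ η * (n : ℝ) ^ 2)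
    (ht : 1 ≤ t) (htn : ∀ j < r + 1, (4 * t : ℝ) ≤ c ^ ((4 * t) ^ j) * n) :
    (labelledFreeGraphs n (completePartiteEqualParts (r + 1) t)).ncard ≤
      #{G : SimpleGraph (Fin n) | ∃ f : Fin n → Fin M, ∃ R : SimpleGraph (Fin M),
        R.CliqueFree (r + 1) ∧
          (#(G.edgeFinset \ (R.comap f).edgeFinset) : ℝ) ≤ η * (n : ℝ) ^ 2} := by
  rw [← Set.ncard_coe_finset]
  refine Set.ncard_le_ncard (fun G hG ↦ ?_) (finite_toSet _)
  simp only [coe_filter, mem_univ, true_and, Set.mem_ofPred_eq]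
  refine (hM G).resolve_left fun h ↦ hG ?_
  refine G.completeEquipartiteGraph_isContained_of_card_cliqueTuples ht hc hc4 ?_ ?_
  · rwa [Fintype.card_fin]
  · simpa only [Fintype.card_fin] using htn

/-- A graph without vertices is contained in every graph. This disposes of `t = 0`, where the box
theorem does not apply. -/
lemma labelledFreeGraphs_completePartiteEqualParts_zero (n k : ℕ) :
    labelledFreeGraphs n (completePartiteEqualParts k 0) = ∅ := by
  refine Set.eq_empty_of_forall_notMem fun G hG ↦ hG ?_
  exact ⟨⟨fun p ↦ p.2.elim0, fun {p} ↦ p.2.elim0⟩, fun p ↦ p.2.elim0⟩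

theorem mainTheorem5 (r : ℕ) (hr : 2 ≤ r) (ε : ℝ) (hε : 0 < ε) :
    ∃ δ : ℝ, 0 < δ ∧ ∃ N : ℕ, ∀ n : ℕ, N ≤ n →
      Real.logb 2
          ((labelledFreeGraphs n
            (completePartiteEqualParts (r + 1) ⌊δ * Real.log n ^ (1 / (r : ℝ))⌋₊)).ncard : ℝ) ≤
        (1 - 1 / (r : ℝ) + ε) * (n.choose 2 : ℝ) := by
  classical
  have hr2 : (2 : ℝ) ≤ r := by exact_mod_cast hr
  have hr0 : 0 ≤ 1 - 1 / (r : ℝ) := by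
    rw [sub_nonneg, div_le_one (by linarith)]
    linarith
  have hr1 : 1 - 1 / (r : ℝ) ≤ 1 := by
    have : 0 ≤ 1 / (r : ℝ) := by positivity
    linarith
  set ρ : ℝ := 1 - 1 / (r : ℝ) with hρ
  -- This makes `2κn² ≤ εn²/8`; the lower-order terms take another `εn²/8`, and `εn²/4` fits into `ε
  -- * n.choose 2` for `n ≥ 2`.
  set κ : ℝ := min 1 (ε / 16) with hκ
  obtain ⟨η, hη, hη1, hsmall⟩ :=
    exists_card_filter_card_le_le_two_rpow (κ := κ) (by positivity) (min_le_left _ _)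
  obtain ⟨M, c₀, hc₀, N₁, hN₁⟩ := SimpleGraph.many_cliques_or_almost_le_blowup (r + 1) hη hη1
  set c : ℝ := min c₀ (1 / 4) with hc
  have hcpos : 0 < c := by positivity
  have hc4 : c ≤ 1 / 4 := min_le_right _ _
  obtain ⟨δ, hδ, N₂, hN₂⟩ := exists_four_mul_floor_le (r := r) (by omega) hcpos (by linarith)
  -- The final `1` absorbs the difference `ρn/2` between `ρn²/2` and `ρ * n.choose 2`.
  set K : ℝ := Real.logb 2 M + M ^ 2 + 1 with hK
  obtain ⟨N₃, hN₃⟩ := exists_nat_ge (8 * K / ε)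
  refine ⟨δ, hδ, max (max N₁ N₂) (max N₃ 2), fun n hn ↦ ?_⟩
  simp only [max_le_iff] at hn
  obtain ⟨⟨hn1, hn2⟩, hn3, hn4⟩ := hn
  have hn4' : (2 : ℝ) ≤ n := by exact_mod_cast hn4
  set t := ⌊δ * Real.log n ^ (1 / (r : ℝ))⌋₊ with ht
  rcases Nat.eq_zero_or_pos (labelledFreeGraphs n (completePartiteEqualParts (r + 1) t)).ncard
    with h0 | hpos
  -- With no free graphs the left side is the default value `Real.logb 2 0 = 0`.
  · rw [h0, Nat.cast_zero, Real.logb_zero]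
    positivity
  have ht1 : 1 ≤ t := by
    by_contra! hlt
    rw [Nat.lt_one_iff.1 hlt, labelledFreeGraphs_completePartiteEqualParts_zero,
      Set.ncard_empty] at hpos
    exact hpos.ne rfl
  have htδ : (t : ℝ) ≤ δ * Real.log n ^ (1 / (r : ℝ)) := by
    refine Nat.floor_le (mul_nonneg hδ.le (Real.rpow_nonneg (Real.log_nonneg ?_) _))
    linarith
  have hcount := labelledFreeGraphs_ncard_le (η := η) (M := M) hcpos hc4 (fun G ↦
    (hN₁ n hn1 G).imp_left fun h ↦ le_trans (by gcongr; exact min_le_left _ _) h) ht1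
    (hN₂ n hn2 t ht1 htδ)
  have hE : #(⊤ : SimpleGraph (Fin n)).edgeFinset ≤ n ^ 2 := by
    rw [SimpleGraph.card_edgeFinset_top_eq_card_choose_two, Fintype.card_fin]
    exact Nat.choose_le_pow n 2
  have hM0 : 0 < M := by
    by_contra! hM
    obtain rfl : M = 0 := by omega
    have : NeZero n := ⟨by omega⟩
    rw [filter_false_of_mem (fun G _ ⟨f, _⟩ ↦ (f 0).elim0)] at hcount
    simp at hcount
    omega
  have hM0' : (0 : ℝ) < M := by exact_mod_cast hM0
  have hbound : ((labelledFreeGraphs n (completePartiteEqualParts (r + 1) t)).ncard : ℝ) ≤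
      2 ^ (n * Real.logb 2 M + (M : ℝ) ^ 2 + ρ * ((n : ℝ) ^ 2 / 2) + 2 * κ * (n : ℝ) ^ 2) := by
    refine le_trans (Nat.cast_le.2 hcount)
      ((SimpleGraph.card_filter_almost_le_blowup_le (by omega) _).trans ?_)
    rw [Real.rpow_add two_pos, Real.rpow_add two_pos, Real.rpow_add two_pos]
    have hM1 : (2 : ℝ) ^ (n * Real.logb 2 M) = (M : ℝ) ^ n := by
      rw [mul_comm, Real.rpow_mul_natCast two_pos.le,
        Real.rpow_logb two_pos (by norm_num) hM0']
    have hM2 : (2 : ℝ) ^ ((M : ℝ) ^ 2) = 2 ^ M ^ 2 := by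
      exact_mod_cast Real.rpow_natCast 2 (M ^ 2)
    rw [hM1, hM2]
    exact mul_le_mul_of_nonneg_left (hsmall n _ hE) (by positivity)
  have hlog := (Real.logb_le_iff_le_rpow (b := 2) (by norm_num) (by exact_mod_cast hpos)).2 hbound
  refine hlog.trans ?_
  have hKn : 8 * K ≤ ε * n := by
    have := hN₃.trans (by exact_mod_cast hn3 : (N₃ : ℝ) ≤ n)
    rwa [div_le_iff₀' hε] at this
  have hchoose : (n.choose 2 : ℝ) = n * (n - 1) / 2 := Nat.cast_choose_two ℝ n
  have hκε : κ ≤ ε / 16 := min_le_right _ _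
  have hlogM : 0 ≤ Real.logb 2 M :=
    Real.logb_nonneg (by norm_num) (by exact_mod_cast hM0)
  rw [hchoose]
  have e1 : 2 * κ * (n : ℝ) ^ 2 ≤ ε / 8 * (n : ℝ) ^ 2 := by
    gcongr
    linarith
  have e2 : (n : ℝ) * Real.logb 2 M + (M : ℝ) ^ 2 + n / 2 ≤ n * K := by
    have : (M : ℝ) ^ 2 ≤ n * (M : ℝ) ^ 2 := le_mul_of_one_le_left (by positivity) (by linarith)
    rw [hK]
    linarith
  have e3 : n * K ≤ ε / 8 * (n : ℝ) ^ 2 := by nlinarith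
  have e4 : ρ * (n / 2 : ℝ) ≤ n / 2 := mul_le_of_le_one_left (by positivity) hr1
  have e5 : ε / 4 * (n : ℝ) ^ 2 ≤ ε * (n * (n - 1) / 2) := by
    nlinarith [mul_nonneg hε.le (mul_nonneg (by linarith : (0 : ℝ) ≤ n)
      (by linarith : (0 : ℝ) ≤ (n : ℝ) - 2))]
  linarith
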